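/- Let $k$ be an arbitrary field. A variety over $k$ means an integral separated scheme of finite type over $k$. For a normal variety $Z$ over $k$, let $\operatorname{Cl} Z$ be the group of Weil divisors (the free abelian group on the points of codimension one) modulo principal divisors, and regard $\operatorname{Pic} Z$ as the subgroup of $\operatorname{Cl} Z$ consisting of the classes of Cartier divisors. Let $\phi : Y \to X$ be a birational morphism (over $k$) of normal quasi-projective varieties over $k$. Let $\operatorname{Ex}(\phi) \subset Y$ be the exceptional locus, i.e. the complement of the largest open subset of $Y$ on which $\phi$ is an isomorphism onto its image, and suppose that $\operatorname{Ex}(\phi)$ has codimension $\geq 2$ in $Y$ (the empty set being allowed). Suppose moreover that $\dim_{\mathbb{Q}} \left(\frac{\operatorname{Cl} X}{\operatorname{Pic} X} \otimes_{\mathbb{Z}} \mathbb{Q}\right) < \infty$. If $\phi$ is not an open immersion, then $$\dim_{\mathbb{Q}} \left(\frac{\operatorname{Cl} Y}{\operatorname{Pic} Y} \otimes_{\mathbb{Z}} \mathbb{Q}\right) < \dim_{\mathbb{Q}} \left(\frac{\operatorname{Cl} X}{\operatorname{Pic} X} \otimes_{\mathbb{Z}} \mathbb{Q}\right).$$ 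-/

import Mathlib

open CategoryTheory AlgebraicGeometry

universe u

noncomputable section

namespace DivisorClass

/-- A variety over a field `k`: an integral separated scheme of finite type over `k`. -/
structure Variety (k : Type u) [Field k] where
  /-- the underlying scheme -/
  scheme : Scheme.{u}
  /-- the structure morphism -/
  hom : scheme ⟶ Spec (CommRingCat.of k)
  isIntegral : IsIntegral scheme
  isSeparated : IsSeparated hom
  locallyOfFiniteType : LocallyOfFiniteType hom
  quasiCompact : QuasiCompact hom

attribute [instance] Variety.isIntegral Variety.isSeparated Variety.locallyOfFiniteType
  Variety.quasiCompact

instance Variety.isLocallyNoetherian {k : Type u} [Field k] (X : Variety k) :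
    IsLocallyNoetherian X.scheme :=
  LocallyOfFiniteType.isLocallyNoetherian X.hom

/-- A scheme is normal if all of its local rings are integrally closed domains
(the local rings of an integral scheme are domains). -/
def IsNormal (X : Scheme.{u}) : Prop :=
  ∀ x : X, IsDomain (X.presheaf.stalk x) ∧ IsIntegrallyClosed (X.presheaf.stalk x)

instance gradedPolynomialRing (k : Type u) [Field k] (n : ℕ) :
    GradedAlgebra (MvPolynomial.homogeneousSubmodule (Fin (n + 1)) k) :=
  MvPolynomial.gradedAlgebra

/-- Projective `n`-space over `k`, as `Proj k[x₀, …, xₙ]` with the standard grading. -/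
def projectiveSpace (k : Type u) [Field k] (n : ℕ) : Scheme.{u} :=
  Proj (MvPolynomial.homogeneousSubmodule (Fin (n + 1)) k)

/-- The structure morphism of projective `n`-space: `Proj A ⟶ Spec A₀ ⟶ Spec k`. -/
def projectiveSpaceHom (k : Type u) [Field k] (n : ℕ) :
    projectiveSpace k n ⟶ Spec (CommRingCat.of k) :=
  Proj.toSpecZero (MvPolynomial.homogeneousSubmodule (Fin (n + 1)) k) ≫
    Spec.map (CommRingCat.ofHom
      (algebraMap k (MvPolynomial.homogeneousSubmodule (Fin (n + 1)) k 0)))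

/-- A variety over `k` is quasi-projective if it admits an immersion over `k` (a closed immersion
into an open subscheme) into some projective space over `k`. -/
def Variety.IsQuasiProjective {k : Type u} [Field k] (X : Variety k) : Prop :=
  ∃ (n : ℕ) (i : X.scheme ⟶ projectiveSpace k n),
    IsImmersion i ∧ i ≫ projectiveSpaceHom k n = X.hom

/-- A morphism is birational if it restricts to an isomorphism from a dense open subscheme of
the source onto a dense open subscheme of the target. -/
def IsBirational {Y X : Scheme.{u}} (φ : Y ⟶ X) : Prop :=
  ∃ p : Y.PartialIso X, p.iso.hom ≫ p.target.ι = p.source.ι ≫ φ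

/-- The exceptional locus of a birational morphism of varieties: the complement of the largest
open subset on which the morphism is an isomorphism onto an open subscheme of the target. -/
def exceptionalLocus {Y X : Scheme.{u}} (φ : Y ⟶ X) : Set Y :=
  ((sSup {U : Y.Opens | IsOpenImmersion (U.ι ≫ φ)} : Y.Opens) : Set Y)ᶜ

/-- The codimension of a closed subset `Z`: the infimum, over the points `z` of `Z`, of the
codimension of the closure of `z` (the length of a longest chain of generalizations of `z`).
The codimension of the empty set is `⊤`. -/
def codim {X : Scheme.{u}} (Z : Set X) : ℕ∞ := ⨅ z ∈ Z, Order.coheight z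

section Divisors

variable (X : Scheme.{u})

/-- Prime divisors, represented by their generic points: the points of codimension one. -/
abbrev PrimeDivisor : Type u := {x : X // Order.coheight x = 1}

/-- The group `Div X` of Weil divisors: the free abelian group on the prime divisors. -/
abbrev WeilDivisor : Type u := PrimeDivisor X →₀ ℤ

variable [IsIntegral X] [IsLocallyNoetherian X]

lemma ord_one (x : X) : Scheme.ord (1 : X.functionField) x = 0 := by
  have h := Scheme.ord_mul (x := x) (one_ne_zero (α := X.functionField)) one_ne_zero
  rw [mul_one] at h
  omega

lemma ord_units_mul (f g : X.functionFieldˣ) (x : X) :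
    Scheme.ord ((f * g : X.functionFieldˣ) : X.functionField) x =
      Scheme.ord (f : X.functionField) x + Scheme.ord (g : X.functionField) x := by
  rw [Units.val_mul, Scheme.ord_mul f.ne_zero g.ne_zero]

lemma ord_units_inv (f : X.functionFieldˣ) (x : X) :
    Scheme.ord ((f⁻¹ : X.functionFieldˣ) : X.functionField) x =
      - Scheme.ord (f : X.functionField) x := by
  have h := ord_units_mul X f f⁻¹ x
  rw [mul_inv_cancel, Units.val_one, ord_one] at h
  omega

/-- The group of principal Weil divisors: those of the form `div f = ∑ ord_P(f) P` for a nonzero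
rational function `f`. -/
def principalDivisors : AddSubgroup (WeilDivisor X) where
  carrier := {D | ∃ f : X.functionFieldˣ, ∀ P : PrimeDivisor X,
    D P = Scheme.ord (f : X.functionField) P.1}
  zero_mem' := ⟨1, fun P => by simp [ord_one]⟩
  add_mem' := by
    rintro D E ⟨f, hf⟩ ⟨g, hg⟩
    exact ⟨f * g, fun P => by rw [ord_units_mul, Finsupp.add_apply, hf, hg]⟩
  neg_mem' := by
    rintro D ⟨f, hf⟩
    exact ⟨f⁻¹, fun P => by rw [ord_units_inv, Finsupp.neg_apply, hf]⟩

/-- The divisor class group `Cl X`: Weil divisors modulo principal divisors. -/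
abbrev Cl : Type u := WeilDivisor X ⧸ principalDivisors X

/-- A Cartier divisor on an integral scheme, given by local equations: an open neighbourhood
`chart x` of every point `x` with a nonzero rational function `eqn x` on it, such that on overlaps
the equations differ by a unit of the structure sheaf (equivalently, by a unit of every local
ring at a point of the overlap). -/
structure CartierDivisor where
  /-- an open neighbourhood of each point -/
  chart : X → X.Opens
  mem_chart : ∀ x, x ∈ chart x
  /-- the local equation on each chart -/
  eqn : X → X.functionFieldˣ
  compat : ∀ x y z : X, z ∈ chart x → z ∈ chart y →
    ∃ v : (X.presheaf.stalk z)ˣ,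
      (eqn x : X.functionField) =
        algebraMap (X.presheaf.stalk z) X.functionField v * (eqn y : X.functionField)

variable {X} in
/-- `D` is the Weil divisor associated with the Cartier divisor `C`: at every prime divisor, the
multiplicity of `D` is the order of vanishing of any local equation of `C` there. -/
def CartierDivisor.HasWeilDivisor (C : CartierDivisor X) (D : WeilDivisor X) : Prop :=
  ∀ (x : X) (P : PrimeDivisor X), P.1 ∈ C.chart x →
    D P = Scheme.ord (C.eqn x : X.functionField) P.1

/-- The group of Weil divisors that are Cartier. -/
def cartierDivisors : AddSubgroup (WeilDivisor X) where
  carrier := {D | ∃ C : CartierDivisor X, C.HasWeilDivisor D}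
  zero_mem' :=
    ⟨{ chart := fun _ => ⊤
       mem_chart := fun _ => trivial
       eqn := fun _ => 1
       compat := fun _ _ _ _ _ => ⟨1, by simp⟩ },
      fun _ P _ => by simp [ord_one]⟩
  add_mem' := by
    rintro D E ⟨C, hC⟩ ⟨C', hC'⟩
    refine ⟨{ chart := fun x => C.chart x ⊓ C'.chart x
              mem_chart := fun x => ⟨C.mem_chart x, C'.mem_chart x⟩
              eqn := fun x => C.eqn x * C'.eqn x
              compat := ?_ }, ?_⟩
    · rintro x y z ⟨hx, hx'⟩ ⟨hy, hy'⟩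
      obtain ⟨v, hv⟩ := C.compat x y z hx hy
      obtain ⟨v', hv'⟩ := C'.compat x y z hx' hy'
      refine ⟨v * v', ?_⟩
      rw [Units.val_mul, Units.val_mul, Units.val_mul, hv, hv', map_mul]
      ring
    · rintro x P ⟨hP, hP'⟩
      rw [ord_units_mul, Finsupp.add_apply, hC x P hP, hC' x P hP']
  neg_mem' := by
    rintro D ⟨C, hC⟩
    refine ⟨{ chart := C.chart
              mem_chart := C.mem_chart
              eqn := fun x => (C.eqn x)⁻¹
              compat := ?_ }, ?_⟩
    · intro x y z hx hy
      obtain ⟨v, hv⟩ := C.compat y x z hy hx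
      refine ⟨v, ?_⟩
      rw [Units.val_inv_eq_inv_val, Units.val_inv_eq_inv_val, hv]
      have h0 := (C.eqn y).ne_zero
      rw [hv] at h0
      field_simp [left_ne_zero_of_mul h0, right_ne_zero_of_mul h0]
    · intro x P hP
      rw [ord_units_inv, Finsupp.neg_apply, hC x P hP]

/-- The Picard group of a normal variety as a subgroup of `Cl X`: the classes of Cartier divisors
(on an integral scheme every line bundle is `𝒪(C)` for a Cartier divisor `C`). -/
def pic : AddSubgroup (Cl X) :=
  (cartierDivisors X).map (QuotientAddGroup.mk' (principalDivisors X))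

/-- The rational vector space `(Cl X / Pic X) ⊗ ℚ`. -/
abbrev ClModPicRat : Type u := TensorProduct ℤ ℚ (Cl X ⧸ pic X)

end Divisors

end DivisorClass

end

/-!
Write `K` for the common function field of `X` and `Y`. Since `Ex(φ)` has codimension at least two,
`φ` has isomorphic local rings at every point of `Y` of codimension one, and since `φ` is separated
this embeds the prime divisors of `Y` into those of `X` (`primeDivisorMap_injective`). Forgetting
the coefficients at the other prime divisors of `X` is a surjection `Div X → Div Y`, the strict
transform. It preserves orders of rational functions, so it maps principal divisors to principal
ones and Cartier divisors to Cartier ones, and induces a surjection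
`(Cl X / Pic X) ⊗ ℚ → (Cl Y / Pic Y) ⊗ ℚ`. If the dimension does not drop, this surjection is an
isomorphism of finite-dimensional spaces: a divisor on `X` with Cartier strict transform is
`ℚ`-Cartier (`exists_nsmul_mem_cartierDivisors`). It has to be shown that `φ` is then an open
immersion.

The main point is `apply_eq_zero_of_nsmul_mem_cartierDivisors`: if an effective `ℚ`-Cartier divisor
`E` on `X` has a strict transform that misses `y : Y`, then `E` misses `φ y`. Indeed a local
equation `g` of a multiple of `E` at `φ y` is regular there by Hartogs' lemma, its pullback has
order zero at all prime divisors through `y` and is therefore invertible at `y`, and the map of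
local rings is local. This is applied to two kinds of divisors.

* A prime divisor of `X` that does not come from `Y` has zero strict transform, which is Cartier.
  So no such prime divisor passes through a point `φ y`.
* As `Y` is quasi-projective, for each `y` there is an effective Cartier divisor `H` on `Y`, cut out
  by a homogeneous form, whose complement `W` is an affine neighbourhood of `y`
  (`exists_cartierDivisor_proj`). Pushing `H` forward to `X` shows that each prime divisor of `X`
  through `φ y` comes from a prime divisor of `Y` whose generic point lies in `W`.

So a section of `𝒪_Y` over `W` is regular at all codimension-one points of `X` that specialize to
`φ y`, hence at `φ y` by Hartogs' lemma. As `𝒪_{Y, y}` is a localization of `Γ(Y, W)`, the map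
`𝒪_{X, φ y} → 𝒪_{Y, y}` is bijective (`stalkMap_bijective_of_rank_not_lt`). This holds at every `y`,
so `φ` is flat, and it is a monomorphism because it is separated and birational
(`eq_of_isIso_stalkMap`); a flat monomorphism of finite presentation is an open immersion.
-/

noncomputable section

namespace DivisorClass

/-! ### Hartogs' lemma and orders at points of codimension one -/

section

/-- A fraction that does not lie in an integrally closed noetherian domain `R` has all its
denominators in some prime of height one. The prime is an associated prime of `K / R`. -/
theorem exists_height_eq_one_of_notMem_range {R K : Type*} [CommRing R] [IsDomain R]
    [IsNoetherianRing R] [IsIntegrallyClosed R] [Field K] [Algebra R K] [IsFractionRing R K]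
    {f : K} (hf : f ∉ (algebraMap R K).range) :
    ∃ p : Ideal R, p.IsPrime ∧ p.height = 1 ∧
      ∀ r : R, algebraMap R K r * f ∈ (algebraMap R K).range → r ∈ p := by
  have hinj : Function.Injective (algebraMap R K) := IsFractionRing.injective R K
  let N : Submodule R K := LinearMap.range (Algebra.linearMap R K)
  have hN : ∀ z : K, z ∈ N ↔ z ∈ (algebraMap R K).range := fun z => by
    simp [N, RingHom.mem_range]
  have hx : (Submodule.Quotient.mk f : K ⧸ N) ≠ 0 := by
    rwa [Ne, Submodule.Quotient.mk_eq_zero, hN]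
  obtain ⟨P, hP, hle⟩ := exists_le_isAssociatedPrime_of_isNoetherianRing R _ hx
  rw [isAssociatedPrime_iff] at hP
  obtain ⟨hprime, z, hz⟩ := hP
  obtain ⟨h, rfl⟩ := Submodule.Quotient.mk_surjective N z
  have hmem : ∀ (g : K) (r : R), r ∈ (⊥ : Submodule R (K ⧸ N)).colon {Submodule.Quotient.mk g} ↔
      algebraMap R K r * g ∈ (algebraMap R K).range := fun g r => by
    rw [Submodule.mem_colon_singleton, Submodule.mem_bot, ← Submodule.Quotient.mk_smul,
      Submodule.Quotient.mk_eq_zero, hN, Algebra.smul_def]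
  have hPmem : ∀ r : R, r ∈ P ↔ algebraMap R K r * h ∈ (algebraMap R K).range := fun r => by
    rw [hz, hmem]
  have hhN : h ∉ (algebraMap R K).range := fun hh => by
    apply hprime.ne_top
    rw [Ideal.eq_top_iff_one, hPmem, map_one, one_mul]
    exact hh
  have hbot : P ≠ ⊥ := by
    obtain ⟨a, b, hb, rfl⟩ := IsFractionRing.div_surjective (A := R) h
    have hb0 : b ≠ 0 := nonZeroDivisors.ne_zero hb
    refine fun hP => hb0 ?_
    have : b ∈ P := by
      rw [hPmem]
      refine ⟨a, ?_⟩
      field_simp [(map_ne_zero_iff _ hinj).mpr hb0]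
    simpa [hP] using this
  refine ⟨P, hprime, ?_, fun r hr => hle ((hmem f r).mpr hr)⟩
  -- If `P h ⊆ P`, then `h` is integral over `R`; so some `π ∈ P` has `u = π h ∈ R \ P`.
  obtain ⟨π, hπ, u, hu, huP⟩ : ∃ π ∈ P, ∃ u, algebraMap R K u = algebraMap R K π * h ∧ u ∉ P := by
    by_contra! hcon
    let M : Submodule R K := Submodule.map (Algebra.linearMap R K) P
    have hint : IsIntegral R h := by
      refine isIntegral_of_smul_mem_submodule (R := R) (A := K) (M := K) M ?_ ?_ h ?_
      · obtain ⟨b, hbP, hb0⟩ := Submodule.exists_mem_ne_zero_of_ne_bot hbot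
        rw [Submodule.ne_bot_iff]
        exact ⟨algebraMap R K b, ⟨b, hbP, rfl⟩, (map_ne_zero_iff _ hinj).mpr hb0⟩
      · exact Submodule.FG.map _ (IsNoetherian.noetherian P)
      · rintro _ ⟨b, hbP, rfl⟩
        obtain ⟨c, hc⟩ := (hPmem b).mp hbP
        refine ⟨c, hcon b hbP c hc, ?_⟩
        rw [Algebra.linearMap_apply, Algebra.linearMap_apply, hc, smul_eq_mul, mul_comm]
    obtain ⟨y, hy⟩ := IsIntegrallyClosed.algebraMap_eq_of_integral hint
    exact hhN ⟨y, hy⟩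
  -- Then `u P ⊆ (π)`, so `P` is a minimal prime of `(π)` and Krull's theorem applies.
  apply le_antisymm
  · refine Ideal.height_le_one_of_isPrincipal_of_mem_minimalPrimes (Ideal.span {π}) P ?_
    refine ⟨⟨hprime, (Ideal.span_singleton_le_iff_mem _).mpr hπ⟩, fun Q hQ hQP q hq => ?_⟩
    obtain ⟨c, hc⟩ := (hPmem q).mp hq
    have hqu : q * u = π * c := by
      apply hinj
      rw [map_mul, map_mul, hu, hc]
      ring
    have hmemQ : q * u ∈ Q := by
      rw [hqu]
      exact Q.mul_mem_right _ ((Ideal.span_singleton_le_iff_mem _).mp hQ.2)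
    exact (hQ.1.mem_or_mem hmemQ).resolve_right fun h' => huP (hQP h')
  · rw [Order.one_le_iff_ne_zero, Ne, Ideal.height_eq_zero_iff_eq_bot]
    exact hbot

variable {X : Scheme.{u}}

/-- The codimension of a generization of `x` can be computed in `Spec 𝒪_{X, x}`, which is embedded
in `X` as the set of all generizations of `x`. -/
theorem coheight_fromSpecStalk (x : X) (p : Spec (X.presheaf.stalk x)) :
    Order.coheight (X.fromSpecStalk x p) = Order.coheight p := by
  have hemb : Topology.IsEmbedding (X.fromSpecStalk x) := (X.fromSpecStalk x).isEmbedding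
  have hle : ∀ a b : Spec (X.presheaf.stalk x),
      X.fromSpecStalk x a ≤ X.fromSpecStalk x b ↔ a ≤ b := fun a b =>
    hemb.specializes_iff
  refine (Order.coheight_eq_of_strictMono (X.fromSpecStalk x) (fun a b hab => ?_)
    (fun a b hab => ?_) p).symm
  · rw [lt_iff_le_not_ge] at hab ⊢
    rwa [hle, hle]
  · have hb : b ∈ Set.range (X.fromSpecStalk x) := by
      rw [Scheme.range_fromSpecStalk]
      have h1 : X.fromSpecStalk x a ∈ Set.range (X.fromSpecStalk x) := ⟨a, rfl⟩
      rw [Scheme.range_fromSpecStalk] at h1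
      exact Specializes.trans (show b ⤳ X.fromSpecStalk x a from hab.le) h1
    obtain ⟨b, rfl⟩ := hb
    refine ⟨b, ?_, rfl⟩
    rw [lt_iff_le_not_ge] at hab ⊢
    rwa [hle, hle] at hab

variable [IsIntegral X]

theorem algebraMap_stalkSpecializes {x y : X} (h : x ⤳ y) (a : X.presheaf.stalk y) :
    algebraMap (X.presheaf.stalk x) X.functionField (X.presheaf.stalkSpecializes h a) =
      algebraMap (X.presheaf.stalk y) X.functionField a := by
  simp [RingHom.algebraMap_toAlgebra, ← ConcreteCategory.comp_apply]

/-- An element of the local ring at `η` is, as a rational function, a quotient of elements of the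
local ring at any specialization `x` of `η`, with denominator outside of the prime of `η`. -/
theorem exists_mul_mem_range_of_mem_range_fromSpecStalk (x : X)
    (p : Spec (X.presheaf.stalk x)) {f : X.functionField}
    (hf : f ∈ (algebraMap (X.presheaf.stalk (X.fromSpecStalk x p)) X.functionField).range) :
    ∃ b : X.presheaf.stalk x, b ∉ p.asIdeal ∧
      algebraMap _ X.functionField b * f ∈
        (algebraMap (X.presheaf.stalk x) X.functionField).range := by
  obtain ⟨g, rfl⟩ := hf
  obtain ⟨U, hU, hxU, -⟩ := exists_isAffineOpen_mem_and_subset (X := X) (x := x) (U := ⊤) trivial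
  have hspec : X.fromSpecStalk x p ⤳ x := by
    have h1 : X.fromSpecStalk x p ∈ Set.range (X.fromSpecStalk x) := ⟨p, rfl⟩
    rwa [Scheme.range_fromSpecStalk] at h1
  have hpU : X.fromSpecStalk x p ∈ U := hspec.mem_open U.2 hxU
  have : Nonempty U := ⟨⟨x, hxU⟩⟩
  have hloc := hU.isLocalization_stalk ⟨X.fromSpecStalk x p, hpU⟩
  let _alg := TopCat.Presheaf.algebra_section_stalk X.presheaf (⟨X.fromSpecStalk x p, hpU⟩ : U)
  obtain ⟨⟨a, s⟩, has⟩ :=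
    IsLocalization.surj (hU.primeIdealOf ⟨X.fromSpecStalk x p, hpU⟩).asIdeal.primeCompl g
  have hs : IsUnit (X.presheaf.germ U _ hpU s.1) :=
    IsLocalization.map_units (X.presheaf.stalk (X.fromSpecStalk x p)) s
  refine ⟨X.presheaf.germ U x hxU s.1, fun hsp => ?_, X.presheaf.germ U x hxU a, ?_⟩
  · have h1 : X.fromSpecStalk x p ∈ X.basicOpen s.1 := by
      rwa [Scheme.mem_basicOpen X s.1 _ hpU]
    have h2 : p ∈ X.fromSpecStalk x ⁻¹ᵁ X.basicOpen s.1 := h1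
    rw [Scheme.preimage_basicOpen, Scheme.fromSpecStalk_app hxU] at h2
    rw [CommRingCat.comp_apply, CommRingCat.comp_apply, Scheme.basicOpen_res] at h2
    have h3 := h2.2
    rw [basicOpen_eq_of_affine] at h3
    exact h3 hsp
  · have h1 : g * X.presheaf.germ U _ hpU s.1 = X.presheaf.germ U _ hpU a := has
    have h2 := congrArg (algebraMap _ X.functionField) h1
    rw [map_mul, Scheme.algebraMap_germ_eq_germToFunctionField,
      Scheme.algebraMap_germ_eq_germToFunctionField] at h2
    rw [Scheme.algebraMap_germ_eq_germToFunctionField,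
      Scheme.algebraMap_germ_eq_germToFunctionField, ← h2, mul_comm]

variable [IsLocallyNoetherian X]

/-- Algebraic Hartogs' lemma: a rational function that is regular at all points of codimension one
specializing to a normal point `x` is regular at `x`. -/
theorem mem_range_algebraMap_stalk_of_forall_coheight_eq_one (x : X)
    (hx : IsIntegrallyClosed (X.presheaf.stalk x)) {f : X.functionField}
    (hf : ∀ η : X, η ⤳ x → Order.coheight η = 1 →
      f ∈ (algebraMap (X.presheaf.stalk η) X.functionField).range) :
    f ∈ (algebraMap (X.presheaf.stalk x) X.functionField).range := by
  by_contra hcon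
  obtain ⟨p, hp, hht, hden⟩ := exists_height_eq_one_of_notMem_range hcon
  let q : Spec (X.presheaf.stalk x) := ⟨p, hp⟩
  have hspec : X.fromSpecStalk x q ⤳ x := by
    have h1 : X.fromSpecStalk x q ∈ Set.range (X.fromSpecStalk x) := ⟨q, rfl⟩
    rwa [Scheme.range_fromSpecStalk] at h1
  have hco : Order.coheight (X.fromSpecStalk x q) = 1 := by
    rw [coheight_fromSpecStalk, ← idealHeight_eq_coheight]
    exact hht
  obtain ⟨b, hb, hbf⟩ := exists_mul_mem_range_of_mem_range_fromSpecStalk x q (hf _ hspec hco)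
  exact hb (hden b hbf)

theorem isDiscreteValuationRing_stalk {η : X} (hη : Order.coheight η = 1)
    (hη' : IsIntegrallyClosed (X.presheaf.stalk η)) :
    IsDiscreteValuationRing (X.presheaf.stalk η) := by
  have hdim := ringKrullDim_stalk_eq_coheight η
  rw [hη] at hdim
  have hle : Ring.KrullDimLE 1 (X.presheaf.stalk η) := krullDimLE_of_coheight_le hη.le
  have hf : ¬ IsField (X.presheaf.stalk η) := fun h => by
    rw [ringKrullDim_eq_zero_of_isField h] at hdim
    exact absurd hdim (by decide)
  have hiff : IsDiscreteValuationRing (X.presheaf.stalk η) ↔ IsIntegrallyClosed (X.presheaf.stalk η) ∧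
      ∃! P : Ideal (X.presheaf.stalk η), P ≠ ⊥ ∧ P.IsPrime :=
    (IsDiscreteValuationRing.TFAE (X.presheaf.stalk η) hf).out 0 3
  refine hiff.mpr ⟨hη', IsLocalRing.maximalIdeal _, ⟨?_, inferInstance⟩, fun P hP => ?_⟩
  · rwa [Ne, ← IsLocalRing.isField_iff_maximalIdeal_eq]
  · have := (Ring.krullDimLE_one_iff_of_isPrime_bot.mp hle) P hP.1 hP.2
    exact IsLocalRing.eq_maximalIdeal this

theorem mem_range_of_ord_nonneg {η : X} (hη : Order.coheight η = 1)
    (hη' : IsIntegrallyClosed (X.presheaf.stalk η)) {f : X.functionField} (hf : f ≠ 0)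
    (h : 0 ≤ Scheme.ord f η) : f ∈ (algebraMap (X.presheaf.stalk η) X.functionField).range := by
  have := isDiscreteValuationRing_stalk hη hη'
  have h1 := (Scheme.le_ord_iff hη hf (n := 0)).mp h
  rw [ofAdd_zero, WithZero.coe_one] at h1
  have h2 : Scheme.ordHom η hη f = Ring.ordFrac (X.presheaf.stalk η) f := rfl
  rw [h2, Ring.ordFrac_eq_valuation_inv, one_le_inv₀] at h1
  · obtain ⟨a, ha⟩ := IsDiscreteValuationRing.exists_lift_of_le_one h1
    exact ⟨a, ha⟩
  · simpa [zero_lt_iff] using hf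

theorem ord_nonneg_of_mem_range {η : X} {f : X.functionField}
    (h : f ∈ (algebraMap (X.presheaf.stalk η) X.functionField).range) :
    0 ≤ Scheme.ord f η := by
  by_cases hη : Order.coheight η = 1
  swap
  · rw [Scheme.ord_eq_zero_of_coheight_neq_one hη]
  have hle : Ring.KrullDimLE 1 (X.presheaf.stalk η) := krullDimLE_of_coheight_le hη.le
  obtain ⟨a, rfl⟩ := h
  by_cases ha : a = 0
  · simp [ha]
  rw [Scheme.le_ord_iff hη (by simpa using ha), ofAdd_zero, WithZero.coe_one]
  exact Ring.ordFrac_ge_one_of_ne_zero ha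

theorem ord_algebraMap_unit (η : X) (a : (X.presheaf.stalk η)ˣ) :
    Scheme.ord (algebraMap (X.presheaf.stalk η) X.functionField a) η = 0 := by
  apply le_antisymm
  · have h := ord_nonneg_of_mem_range (η := η)
      (f := algebraMap (X.presheaf.stalk η) X.functionField ↑a⁻¹) ⟨_, rfl⟩
    have h2 : Scheme.ord (algebraMap (X.presheaf.stalk η) X.functionField a *
      algebraMap (X.presheaf.stalk η) X.functionField ↑a⁻¹) η = 0 := by
      rw [← map_mul, Units.mul_inv, map_one, ord_one]
    rw [Scheme.ord_mul (by simp) (by simp)] at h2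
    omega
  · exact ord_nonneg_of_mem_range ⟨_, rfl⟩

theorem isUnit_of_ord_algebraMap_eq_zero {η : X} (hη : Order.coheight η = 1)
    {a : X.presheaf.stalk η} (ha : a ≠ 0)
    (h : Scheme.ord (algebraMap (X.presheaf.stalk η) X.functionField a) η = 0)
    (hη' : IsIntegrallyClosed (X.presheaf.stalk η)) : IsUnit a := by
  have := isDiscreteValuationRing_stalk hη hη'
  rw [Ring.isUnit_iff_ordFrac_one_of_isDiscreteValuationRing (K := X.functionField)]
  exact (Scheme.ord_eq_iff hη (by simpa using ha)).mp h

end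

/-! ### Birational morphisms and local rings -/

section

variable {X Y : Scheme.{u}}

theorem isIso_stalkMap_of_isOpenImmersion_ι_comp (φ : Y ⟶ X) (U : Y.Opens)
    [IsOpenImmersion (U.ι ≫ φ)] {y : Y} (hy : y ∈ U) : IsIso (φ.stalkMap y) := by
  let u : U.toScheme := ⟨y, hy⟩
  have h1 : IsIso ((U.ι ≫ φ).stalkMap u) := inferInstance
  rw [Scheme.Hom.stalkMap_comp] at h1
  exact (isIso_comp_right_iff (φ.stalkMap (U.ι u)) (U.ι.stalkMap u)).mp h1

theorem coheight_eq_of_isIso_stalkMap (φ : Y ⟶ X) (y : Y) [IsIso (φ.stalkMap y)] :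
    Order.coheight (φ y) = Order.coheight y := by
  have h1 := ringKrullDim_stalk_eq_coheight y
  have h2 := ringKrullDim_stalk_eq_coheight (φ y)
  rw [ringKrullDim_eq_of_ringEquiv (asIso (φ.stalkMap y)).commRingCatIsoToRingEquiv, h1] at h2
  exact_mod_cast h2.symm

/-- The lift of `Spec 𝒪_{X, x}` to `Y` through a point `y` over `x` with isomorphic local ring. -/
def liftSpecStalk (φ : Y ⟶ X) {x : X} {y : Y} (hy : φ y = x) [IsIso (φ.stalkMap y)] :
    Spec (X.presheaf.stalk x) ⟶ Y :=
  Spec.map (inv (φ.stalkMap y) ≫ X.presheaf.stalkSpecializes (specializes_of_eq hy.symm)) ≫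
    Y.fromSpecStalk y

theorem liftSpecStalk_closedPoint (φ : Y ⟶ X) {x : X} {y : Y} (hy : φ y = x) [IsIso (φ.stalkMap y)] :
    liftSpecStalk φ hy (IsLocalRing.closedPoint _) = y := by
  subst hy
  have h1 : X.presheaf.stalkSpecializes (specializes_of_eq (Eq.refl (φ y)).symm) = 𝟙 _ :=
    TopCat.Presheaf.stalkSpecializes_refl _ _
  rw [liftSpecStalk, h1, Category.comp_id]
  change Y.fromSpecStalk y (Spec.map (inv (φ.stalkMap y)) _) = y
  have h2 : Spec.map (inv (φ.stalkMap y)) (IsLocalRing.closedPoint (X.presheaf.stalk (φ y))) =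
      IsLocalRing.closedPoint (Y.presheaf.stalk y) :=
    IsLocalRing.comap_closedPoint (inv (φ.stalkMap y)).hom
  rw [h2, Scheme.fromSpecStalk_closedPoint]

theorem liftSpecStalk_comp (φ : Y ⟶ X) {x : X} {y : Y} (hy : φ y = x) [IsIso (φ.stalkMap y)] :
    liftSpecStalk φ hy ≫ φ = X.fromSpecStalk x := by
  subst hy
  have h1 : X.presheaf.stalkSpecializes (specializes_of_eq (Eq.refl (φ y)).symm) = 𝟙 _ :=
    TopCat.Presheaf.stalkSpecializes_refl _ _
  rw [liftSpecStalk, h1, Category.comp_id, Category.assoc,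
    ← Scheme.SpecMap_stalkMap_fromSpecStalk, ← Spec.map_comp_assoc, IsIso.hom_inv_id,
    Spec.map_id, Category.id_comp]

variable [IsIntegral X] [IsIntegral Y]

/-- Pullback of rational functions along a morphism of integral schemes that maps the generic point
to the generic point. -/
def functionFieldMap (φ : Y ⟶ X) (h : φ (genericPoint Y) = genericPoint X) :
    X.functionField ⟶ Y.functionField :=
  X.presheaf.stalkSpecializes (specializes_of_eq h) ≫ φ.stalkMap (genericPoint Y)

section

variable (φ : Y ⟶ X) (h : φ (genericPoint Y) = genericPoint X)

theorem isIso_functionFieldMap [IsIso (φ.stalkMap (genericPoint Y))] :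
    IsIso (functionFieldMap φ h) := by
  have : IsIso (X.presheaf.stalkSpecializes (specializes_of_eq h)) :=
    (X.presheaf.stalkCongr (Inseparable.of_eq h)).isIso_inv
  rw [functionFieldMap]
  infer_instance

theorem stalkSpecializes_functionFieldMap (y : Y) :
    X.presheaf.stalkSpecializes ((genericPoint_spec X).specializes trivial) ≫
      functionFieldMap φ h =
    φ.stalkMap y ≫ Y.presheaf.stalkSpecializes ((genericPoint_spec Y).specializes trivial) := by
  rw [functionFieldMap, TopCat.Presheaf.stalkSpecializes_comp_assoc]
  exact Scheme.Hom.stalkSpecializes_stalkMap φ _ _ _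

theorem functionFieldMap_algebraMap (y : Y) (a : X.presheaf.stalk (φ y)) :
    functionFieldMap φ h (algebraMap _ X.functionField a) =
      algebraMap (Y.presheaf.stalk y) Y.functionField (φ.stalkMap y a) :=
  congr($(stalkSpecializes_functionFieldMap φ h y).hom a)

/-- A rational function regular at `φ y` is invertible there if its pullback is invertible at `y`. -/
theorem isUnit_of_isUnit_functionFieldMap {y : Y} {g : X.functionField}
    (hg : g ∈ (algebraMap (X.presheaf.stalk (φ y)) X.functionField).range)
    {v : (Y.presheaf.stalk y)ˣ}
    (hv : functionFieldMap φ h g = algebraMap (Y.presheaf.stalk y) Y.functionField v) :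
    ∃ w : (X.presheaf.stalk (φ y))ˣ, g = algebraMap _ X.functionField w.1 := by
  obtain ⟨a, rfl⟩ := hg
  rw [functionFieldMap_algebraMap] at hv
  have hv' := IsFractionRing.injective (Y.presheaf.stalk y) Y.functionField hv
  have ha : IsUnit a := isUnit_of_map_unit (φ.stalkMap y).hom a (by
    change IsUnit (φ.stalkMap y a)
    rw [hv']
    exact v.isUnit)
  exact ⟨ha.unit, rfl⟩

/-- The restriction of the lift to the generic point of `X` does not depend on `y`. -/
theorem SpecMap_liftSpecStalk {x : X} {y : Y} (hy : φ y = x) [IsIso (φ.stalkMap y)]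
    [IsIso (functionFieldMap φ h)] :
    Spec.map (X.presheaf.stalkSpecializes ((genericPoint_spec X).specializes (y := x) trivial)) ≫
      liftSpecStalk φ hy =
    Spec.map (inv (functionFieldMap φ h)) ≫ Y.fromSpecStalk (genericPoint Y) := by
  subst hy
  have h1 : X.presheaf.stalkSpecializes (specializes_of_eq (Eq.refl (φ y)).symm) = 𝟙 _ :=
    TopCat.Presheaf.stalkSpecializes_refl _ _
  rw [liftSpecStalk, h1, Category.comp_id, ← Spec.map_comp_assoc,
    ← Scheme.SpecMap_stalkSpecializes_fromSpecStalk
      ((genericPoint_spec Y).specializes (y := y) trivial), ← Spec.map_comp_assoc]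
  congr 2
  rw [IsIso.inv_comp_eq, ← Category.assoc, IsIso.eq_comp_inv]
  exact stalkSpecializes_functionFieldMap φ h y

/-- Two points of `Y` over the same point `x` of `X`, both with local rings isomorphic to
`𝒪_{X, x}`, give two lifts of `Spec 𝒪_{X, x}` to `Y` that agree at the generic point, so they
coincide when `Y` is separated over `X`. -/
theorem eq_of_isIso_stalkMap [IsSeparated φ] [IsIso (functionFieldMap φ h)] {y y' : Y}
    (e : φ y = φ y') [IsIso (φ.stalkMap y)] [IsIso (φ.stalkMap y')] : y = y' := by
  have hdom : IsDominant (Spec.map (X.presheaf.stalkSpecializes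
      ((genericPoint_spec X).specializes (y := φ y') trivial))) := by
    refine ⟨(PrimeSpectrum.denseRange_comap_iff_ker_le_nilRadical _).mpr ?_⟩
    exact ((RingHom.injective_iff_ker_eq_bot _).mp
      (IsFractionRing.injective (X.presheaf.stalk (φ y')) X.functionField)).le.trans bot_le
  have key : liftSpecStalk φ e = liftSpecStalk φ (Eq.refl (φ y')) :=
    ext_of_isDominant_of_isSeparated φ (by rw [liftSpecStalk_comp, liftSpecStalk_comp])
      (Spec.map (X.presheaf.stalkSpecializes
        ((genericPoint_spec X).specializes (y := φ y') trivial)))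
      (by rw [SpecMap_liftSpecStalk φ h, SpecMap_liftSpecStalk φ h])
  rw [← liftSpecStalk_closedPoint φ e, key, liftSpecStalk_closedPoint]

end

section Order

variable [IsLocallyNoetherian X] [IsLocallyNoetherian Y]

theorem ord_algebraMap_irreducible {η : X} (hη : Order.coheight η = 1)
    (hη' : IsIntegrallyClosed (X.presheaf.stalk η)) {π : X.presheaf.stalk η}
    (hπ : Irreducible π) :
    Scheme.ord (algebraMap (X.presheaf.stalk η) X.functionField π) η = 1 := by
  have := isDiscreteValuationRing_stalk hη hη'
  rw [Scheme.ord_eq_iff hη (by simpa using hπ.ne_zero)]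
  exact Ring.ordFrac_irreducible hπ

theorem ord_pow {η : X} {f : X.functionField} (hf : f ≠ 0) (n : ℕ) :
    Scheme.ord (f ^ n) η = n * Scheme.ord f η := by
  induction n with
  | zero => simp [ord_one]
  | succ n ih =>
    rw [pow_succ, Scheme.ord_mul (pow_ne_zero _ hf) hf, ih]
    push_cast
    ring

variable (φ : Y ⟶ X) (h : φ (genericPoint Y) = genericPoint X)

/-- Pullback of rational functions preserves the order at points of codimension one where `φ` has
isomorphic local rings. -/
theorem ord_functionFieldMap {y : Y} (hy : Order.coheight y = 1) [IsIso (φ.stalkMap y)]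
    (hX : IsIntegrallyClosed (X.presheaf.stalk (φ y)))
    (hY : IsIntegrallyClosed (Y.presheaf.stalk y)) {f : X.functionField} (hf : f ≠ 0) :
    Scheme.ord (functionFieldMap φ h f) y = Scheme.ord f (φ y) := by
  have hx : Order.coheight (φ y) = 1 := (coheight_eq_of_isIso_stalkMap φ y).trans hy
  have := isDiscreteValuationRing_stalk hx hX
  let e := (asIso (φ.stalkMap y)).commRingCatIsoToRingEquiv
  have he : ∀ a, φ.stalkMap y a = e a := fun a => rfl
  -- For nonzero `a` in the local ring, both sides are `n`, where `a = u π ^ n`.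
  have key : ∀ a : X.presheaf.stalk (φ y), a ≠ 0 →
      Scheme.ord (functionFieldMap φ h (algebraMap _ X.functionField a)) y =
        Scheme.ord (algebraMap _ X.functionField a) (φ y) := by
    intro a ha
    obtain ⟨π, hπ⟩ := IsDiscreteValuationRing.exists_irreducible (X.presheaf.stalk (φ y))
    obtain ⟨n, w, rfl⟩ := IsDiscreteValuationRing.eq_unit_mul_pow_irreducible ha hπ
    have hπ' : Irreducible (e π) := (MulEquiv.irreducible_iff e.toMulEquiv).mpr hπ
    have hw : e (w : X.presheaf.stalk (φ y)) = (Units.map e.toMonoidHom w : _) := rfl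
    rw [functionFieldMap_algebraMap, he, map_mul, map_mul, map_mul, map_pow, map_pow, map_pow, hw,
      Scheme.ord_mul (by simp) (pow_ne_zero n (by simpa using hπ.ne_zero)),
      Scheme.ord_mul (by simp) (pow_ne_zero n (by simpa using hπ.ne_zero)),
      ord_algebraMap_unit, ord_algebraMap_unit, ord_pow (by simpa using hπ'.ne_zero),
      ord_pow (by simpa using hπ.ne_zero), ord_algebraMap_irreducible hy hY hπ',
      ord_algebraMap_irreducible hx hX hπ]
  obtain ⟨a, b, hb, rfl⟩ := IsFractionRing.div_surjective (A := X.presheaf.stalk (φ y)) f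
  have hb0 : b ≠ 0 := nonZeroDivisors.ne_zero hb
  have ha0 : a ≠ 0 := by
    rintro rfl
    simp at hf
  have hbK : algebraMap _ X.functionField b ≠ 0 := by simpa using hb0
  have hmul : algebraMap _ X.functionField a / algebraMap _ X.functionField b *
      algebraMap _ X.functionField b = algebraMap _ X.functionField a :=
    div_mul_cancel₀ _ hbK
  have h1 := key a ha0
  rw [← hmul, Scheme.ord_mul hf hbK, map_mul, Scheme.ord_mul, key b hb0] at h1
  · omega
  · exact (map_ne_zero (functionFieldMap φ h).hom).mpr hf
  · exact (map_ne_zero (functionFieldMap φ h).hom).mpr hbK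

end Order

end

/-! ### Strict transforms of divisor classes -/

section

open TensorProduct in
/-- A surjection of abelian groups that does not lower a finite rational rank has torsion kernel. -/
theorem exists_nsmul_eq_zero_of_rank_not_lt {M N : Type u} [AddCommGroup M] [AddCommGroup N]
    (f : M →+ N) (hf : Function.Surjective f)
    (hfin : Module.rank ℚ (ℚ ⊗[ℤ] M) < Cardinal.aleph0)
    (hrank : ¬ Module.rank ℚ (ℚ ⊗[ℤ] N) < Module.rank ℚ (ℚ ⊗[ℤ] M)) {m : M} (hm : f m = 0) :
    ∃ n : ℕ, 0 < n ∧ n • m = 0 := by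
  let g : ℚ ⊗[ℤ] M →ₗ[ℚ] ℚ ⊗[ℤ] N := f.toIntLinearMap.baseChange ℚ
  have hg : Function.Surjective g := LinearMap.lTensor_surjective ℚ (g := f.toIntLinearMap) hf
  have hle := LinearMap.rank_le_of_surjective g hg
  have heq := le_antisymm (not_lt.mp hrank) hle
  have : FiniteDimensional ℚ (ℚ ⊗[ℤ] M) := Module.rank_lt_aleph0_iff.mp hfin
  have : FiniteDimensional ℚ (ℚ ⊗[ℤ] N) := Module.rank_lt_aleph0_iff.mp (hle.trans_lt hfin)
  have hginj : Function.Injective g :=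
    (LinearMap.injective_iff_surjective_of_finrank_eq_finrank
      (congrArg Cardinal.toNat heq)).mpr hg
  have h0 : (TensorProduct.mk ℤ ℚ M 1) m = 0 := by
    apply hginj
    rw [map_zero, TensorProduct.mk_apply]
    change (1 : ℚ) ⊗ₜ[ℤ] f m = 0
    rw [hm, TensorProduct.tmul_zero]
  have hloc : IsLocalizedModule (nonZeroDivisors ℤ) (TensorProduct.mk ℤ ℚ M 1) :=
    (isLocalizedModule_iff_isBaseChange (nonZeroDivisors ℤ) ℚ _).mpr
      (TensorProduct.isBaseChange ℤ M ℚ)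
  obtain ⟨⟨c, hc⟩, hcm⟩ := (IsLocalizedModule.eq_zero_iff (nonZeroDivisors ℤ) _).mp h0
  have hcm' : c • m = 0 := hcm
  refine ⟨c.natAbs, Int.natAbs_pos.mpr (nonZeroDivisors.ne_zero hc), ?_⟩
  rw [← natCast_zsmul, Int.natCast_natAbs]
  rcases abs_choice c with h | h <;> simp [h, hcm']

section Pic

variable (X : Scheme.{u}) [IsIntegral X] [IsLocallyNoetherian X]

theorem principalDivisors_le_cartierDivisors : principalDivisors X ≤ cartierDivisors X := by
  rintro D ⟨f, hf⟩
  exact ⟨{ chart := fun _ => ⊤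
           mem_chart := fun _ => trivial
           eqn := fun _ => f
           compat := fun _ _ _ _ _ => ⟨1, by simp⟩ }, fun _ P _ => hf P⟩

variable {X} in
theorem mk_mem_pic_iff {D : WeilDivisor X} :
    (QuotientAddGroup.mk D : Cl X) ∈ pic X ↔ D ∈ cartierDivisors X := by
  refine ⟨?_, fun h => ⟨D, h, rfl⟩⟩
  rintro ⟨E, hE, hED⟩
  have h1 := QuotientAddGroup.eq.mp hED
  have h2 := add_mem hE (principalDivisors_le_cartierDivisors X h1)
  rwa [add_neg_cancel_left] at h2

end Pic

section Pullback

variable {X Y : Scheme.{u}}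

/-- Prime divisors of the source of a morphism that is a local isomorphism in codimension one,
as prime divisors of the target. -/
def primeDivisorMap (φ : Y ⟶ X)
    (hcod : ∀ y : Y, Order.coheight y = 1 → IsIso (φ.stalkMap y)) (Q : PrimeDivisor Y) :
    PrimeDivisor X :=
  ⟨φ Q.1, by
    have := hcod Q.1 Q.2
    exact (coheight_eq_of_isIso_stalkMap φ Q.1).trans Q.2⟩

variable [IsIntegral X] [IsIntegral Y]

variable (φ : Y ⟶ X) (h : φ (genericPoint Y) = genericPoint X)
  (hcod : ∀ y : Y, Order.coheight y = 1 → IsIso (φ.stalkMap y))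

include h
theorem primeDivisorMap_injective [IsSeparated φ] [IsIso (functionFieldMap φ h)] :
    Function.Injective (primeDivisorMap φ hcod) := by
  intro Q Q' e
  have := hcod Q.1 Q.2
  have := hcod Q'.1 Q'.2
  exact Subtype.ext (eq_of_isIso_stalkMap φ h (congrArg Subtype.val e))

variable [IsLocallyNoetherian X] [IsLocallyNoetherian Y]

theorem ord_map_functionFieldMap (hX : IsNormal X) (hY : IsNormal Y) (f : X.functionFieldˣ)
    (Q : PrimeDivisor Y) :
    Scheme.ord (Units.map (functionFieldMap φ h).hom.toMonoidHom f : Y.functionFieldˣ).1 Q.1 =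
      Scheme.ord (f : X.functionField) (primeDivisorMap φ hcod Q).1 := by
  have := hcod Q.1 Q.2
  exact ord_functionFieldMap φ h Q.2 (hX _).2 (hY _).2 f.ne_zero

variable (hinj : Function.Injective (primeDivisorMap φ hcod))

theorem comapDomain_mem_principalDivisors (hX : IsNormal X) (hY : IsNormal Y) {D : WeilDivisor X}
    (hD : D ∈ principalDivisors X) :
    Finsupp.comapDomain.addMonoidHom hinj D ∈ principalDivisors Y := by
  obtain ⟨f, hf⟩ := hD
  refine ⟨Units.map (functionFieldMap φ h).hom.toMonoidHom f, fun Q => ?_⟩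
  rw [ord_map_functionFieldMap φ h hcod hX hY, ← hf]
  rfl

/-- The pullback of a Cartier divisor: local equations are pulled back as rational functions. -/
def CartierDivisor.pullback (C : CartierDivisor X) : CartierDivisor Y where
  chart y := φ ⁻¹ᵁ C.chart (φ y)
  mem_chart y := C.mem_chart (φ y)
  eqn y := Units.map (functionFieldMap φ h).hom.toMonoidHom (C.eqn (φ y))
  compat x y z hx hy := by
    obtain ⟨v, hv⟩ := C.compat (φ x) (φ y) (φ z) hx hy
    refine ⟨Units.map (φ.stalkMap z).hom.toMonoidHom v, ?_⟩
    change functionFieldMap φ h _ =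
      algebraMap _ _ (φ.stalkMap z v.1) * functionFieldMap φ h _
    rw [hv, map_mul, functionFieldMap_algebraMap]

theorem comapDomain_mem_cartierDivisors (hX : IsNormal X) (hY : IsNormal Y) {D : WeilDivisor X}
    (hD : D ∈ cartierDivisors X) :
    Finsupp.comapDomain.addMonoidHom hinj D ∈ cartierDivisors Y := by
  obtain ⟨C, hC⟩ := hD
  refine ⟨C.pullback φ h, fun y Q hQ => ?_⟩
  change D (primeDivisorMap φ hcod Q) = _
  rw [hC (φ y) (primeDivisorMap φ hcod Q) hQ]
  exact (ord_map_functionFieldMap φ h hcod hX hY _ Q).symm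

/-- If `(Cl Y / Pic Y) ⊗ ℚ` is not smaller than `(Cl X / Pic X) ⊗ ℚ`, then a divisor on `X` is
`ℚ`-Cartier as soon as its strict transform on `Y` is Cartier. -/
theorem exists_nsmul_mem_cartierDivisors (hX : IsNormal X) (hY : IsNormal Y)
    (hfin : Module.rank ℚ (ClModPicRat X) < Cardinal.aleph0)
    (hrank : ¬ Module.rank ℚ (ClModPicRat Y) < Module.rank ℚ (ClModPicRat X))
    {D : WeilDivisor X} (hD : Finsupp.comapDomain.addMonoidHom hinj D ∈ cartierDivisors Y) :
    ∃ n : ℕ, 0 < n ∧ n • D ∈ cartierDivisors X := by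
  let F : Cl X →+ Cl Y := QuotientAddGroup.map _ _ (Finsupp.comapDomain.addMonoidHom hinj)
    fun E hE => comapDomain_mem_principalDivisors φ h hcod hinj hX hY hE
  have hF : pic X ≤ (pic Y).comap F := by
    rintro _ ⟨E, hE, rfl⟩
    exact ⟨_, comapDomain_mem_cartierDivisors φ h hcod hinj hX hY hE, rfl⟩
  let G : Cl X ⧸ pic X →+ Cl Y ⧸ pic Y := QuotientAddGroup.map _ _ F hF
  have hG : Function.Surjective G := by
    intro z
    obtain ⟨z, rfl⟩ := QuotientAddGroup.mk_surjective z
    obtain ⟨E, rfl⟩ := QuotientAddGroup.mk_surjective z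
    refine ⟨QuotientAddGroup.mk (QuotientAddGroup.mk (E.mapDomain (primeDivisorMap φ hcod))), ?_⟩
    change QuotientAddGroup.mk (QuotientAddGroup.mk (Finsupp.comapDomain _ _ _)) = _
    rw [Finsupp.comapDomain_mapDomain _ hinj]
  obtain ⟨n, hn, hnD⟩ := exists_nsmul_eq_zero_of_rank_not_lt G hG hfin hrank
    (m := QuotientAddGroup.mk (QuotientAddGroup.mk D))
    ((QuotientAddGroup.eq_zero_iff _).mpr (mk_mem_pic_iff.mpr hD))
  refine ⟨n, hn, mk_mem_pic_iff.mp ((QuotientAddGroup.eq_zero_iff _).mp ?_)⟩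
  exact hnD

end Pullback

end

/-! ### Cartier divisors with affine complement on quasi-projective schemes -/

section

section HomogeneousFractions

open HomogeneousLocalization

variable {σ : Type*} {A : Type u} [CommRing A] [SetLike σ A] [AddSubgroupClass σ A]
  (𝒜 : ℕ → σ) [GradedRing 𝒜]

/-- The element `a / b` of the local ring of `Proj 𝒜` at a point of `D₊(b)`, for homogeneous
elements `a` and `b` of the same degree. -/
def stalkFraction (p : Proj 𝒜) {d : ℕ} {a b : A} (ha : a ∈ 𝒜 d) (hb : b ∈ 𝒜 d)
    (hp : p ∈ Proj.basicOpen 𝒜 b) : (Proj 𝒜).presheaf.stalk p :=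
  (Proj.stalkIso 𝒜 p).inv (HomogeneousLocalization.mk ⟨d, ⟨a, ha⟩, ⟨b, hb⟩, hp⟩)

variable {𝒜}

theorem isUnit_stalkFraction_iff {p : Proj 𝒜} {d : ℕ} {a b : A} (ha : a ∈ 𝒜 d) (hb : b ∈ 𝒜 d)
    (hp : p ∈ Proj.basicOpen 𝒜 b) :
    IsUnit (stalkFraction 𝒜 p ha hb hp) ↔ p ∈ Proj.basicOpen 𝒜 a := by
  have := p.isPrime
  have h1 : IsUnit (stalkFraction 𝒜 p ha hb hp) ↔
      IsUnit (HomogeneousLocalization.mk ⟨d, ⟨a, ha⟩, ⟨b, hb⟩, hp⟩ :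
        AtPrime 𝒜 p.asHomogeneousIdeal.toIdeal) :=
    MulEquiv.isUnit_map (Proj.stalkIso 𝒜 p).symm.commRingCatIsoToRingEquiv
  rw [h1, ← isUnit_iff_isUnit_val, val_mk, Localization.mk_eq_mk',
    IsLocalization.AtPrime.isUnit_mk'_iff]
  rfl

theorem stalkFraction_eq_mul {p : Proj 𝒜} {d : ℕ} {a b c : A} (ha : a ∈ 𝒜 d) (hb : b ∈ 𝒜 d)
    (hc : c ∈ 𝒜 d) (hpb : p ∈ Proj.basicOpen 𝒜 b) (hpc : p ∈ Proj.basicOpen 𝒜 c) :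
    stalkFraction 𝒜 p ha hb hpb = stalkFraction 𝒜 p hc hb hpb * stalkFraction 𝒜 p ha hc hpc := by
  rw [stalkFraction, stalkFraction, stalkFraction, ← map_mul, ← mk_mul]
  congr 1
  rw [ext_iff_val, val_mk, val_mk, Localization.mk_eq_mk_iff, Localization.r_iff_exists]
  refine ⟨1, ?_⟩
  simp
  ring

theorem stalkSpecializes_stalkFraction {p q : Proj 𝒜} (h : p ⤳ q) {d : ℕ} {a b : A}
    (ha : a ∈ 𝒜 d) (hb : b ∈ 𝒜 d) (hq : q ∈ Proj.basicOpen 𝒜 b) :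
    (Proj 𝒜).presheaf.stalkSpecializes h (stalkFraction 𝒜 q ha hb hq) =
      stalkFraction 𝒜 p ha hb (h.mem_open (Proj.basicOpen 𝒜 b).2 hq) := by
  have key : ∀ (p : Proj 𝒜) (hp : p ∈ Proj.basicOpen 𝒜 b),
      (Proj 𝒜).presheaf.germ (Proj.basicOpen 𝒜 b) p hp (Proj.awayToSection 𝒜 b
        (HomogeneousLocalization.mk ⟨d, ⟨a, ha⟩, ⟨b, hb⟩, Submonoid.mem_powers b⟩)) =
      stalkFraction 𝒜 p ha hb hp := fun p hp =>
    DFunLike.congr_fun (congrArg CommRingCat.Hom.hom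
      (ProjectiveSpectrum.Proj.awayToSection_germ 𝒜 b p hp))
        (HomogeneousLocalization.mk ⟨d, ⟨a, ha⟩, ⟨b, hb⟩, Submonoid.mem_powers b⟩)
  rw [← key, ← key p, ← CommRingCat.comp_apply, TopCat.Presheaf.germ_stalkSpecializes]

end HomogeneousFractions

variable {Y : Scheme.{u}} [IsIntegral Y]

/-- Only finitely many points of codimension one lie outside a nonempty open subset. -/
theorem finite_coheight_eq_one_notMem [IsNoetherian Y] (W : Y.Opens) [hW : Nonempty W] :
    {P : Y | Order.coheight P = 1 ∧ P ∉ W}.Finite := by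
  obtain ⟨S, hS, hSW⟩ := TopologicalSpace.NoetherianSpace.exists_finite_set_isClosed_irreducible
    (s := (W : Set Y)ᶜ) W.2.isClosed_compl
  obtain ⟨hScl, hSirr, hSU⟩ := hSW
  classical
  -- A point of codimension one outside `W` is the generic point of a component of `Y \ W`.
  let gen : Set Y → Y := fun t =>
    if ht : IsIrreducible t then ht.genericPoint else genericPoint Y
  refine (hS.image gen).subset ?_
  rintro P ⟨hP, hPW⟩
  have hP' : P ∈ ⋃₀ S := hSU ▸ hPW
  obtain ⟨t, ht, hPt⟩ := hP'
  refine ⟨t, ht, ?_⟩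
  have hirr := hSirr t ht
  have hgen : gen t = hirr.genericPoint := dif_pos hirr
  have hspec := hirr.isGenericPoint_genericPoint_closure
  rw [(hScl t ht).closure_eq] at hspec
  have hle : P ≤ gen t := by
    rw [hgen]
    exact hspec.specializes hPt
  have hne : gen t ≠ genericPoint Y := by
    intro h
    have h1 : gen t ∈ (W : Set Y)ᶜ := by
      rw [hSU, hgen]
      exact ⟨t, ht, hspec.mem⟩
    rw [h] at h1
    exact h1 (((genericPoint_spec Y).mem_open_set_iff W.2).mpr (by simpa using hW))
  by_contra hcon
  have hlt : P < gen t := lt_of_le_not_ge hle fun h => hcon (Specializes.antisymm hle h).eq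
  have hlt' : gen t < genericPoint Y :=
    lt_of_le_not_ge (genericPoint_specializes _) fun h =>
      hne (Specializes.antisymm h (genericPoint_specializes _)).eq
  have h1 := Order.coheight_add_one_le hlt
  have h2 := Order.coheight_add_one_le hlt'
  rw [hP] at h1
  have h3 : (1 : ℕ∞) ≤ Order.coheight (gen t) := le_trans (by simp) h2
  have h4 : (1 : ℕ∞) + 1 ≤ 1 := (add_le_add_left h3 1).trans h1
  exact absurd h4 (by decide)

/-- A scheme immersed in `Proj 𝒜`, where elements of degree one have no common zero, has
around each point an affine open neighbourhood `W` that is the complement of an effective Cartier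
divisor. The divisor is the restriction of `s = 0` for a homogeneous `s` chosen such that the scheme
is closed in a neighbourhood of `D₊(s)`. -/
theorem exists_cartierDivisor_proj {σ : Type*} {A : Type u} [CommRing A] [SetLike σ A]
    [AddSubgroupClass σ A] {𝒜 : ℕ → σ} [GradedRing 𝒜]
    (h1 : ∀ p : Proj 𝒜, ∃ t ∈ 𝒜 1, p ∈ Proj.basicOpen 𝒜 t) (i : Y ⟶ Proj 𝒜) [IsImmersion i]
    (y : Y) :
    ∃ (W : Y.Opens) (C : CartierDivisor Y), IsAffineOpen W ∧ y ∈ W ∧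
      ∀ x z : Y, z ∈ C.chart x → ∃ a : Y.presheaf.stalk z,
        algebraMap _ Y.functionField a = C.eqn x ∧ (IsUnit a ↔ z ∈ W) := by
  obtain ⟨s, d, hd, hs, hys, hsO⟩ : ∃ (s : A) (d : ℕ), 0 < d ∧ s ∈ 𝒜 d ∧
      i y ∈ Proj.basicOpen 𝒜 s ∧ Proj.basicOpen 𝒜 s ≤ i.coborderRange := by
    have hy : i y ∈ i.coborderRange := subset_coborder ⟨y, rfl⟩
    obtain ⟨_, ⟨_, ⟨f, rfl⟩, rfl⟩, hyf, hfO⟩ :=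
      (Proj.isBasis_basicOpen 𝒜).exists_subset_of_mem_open hy i.coborderRange.2
    have hyf' : i y ∈ Proj.basicOpen 𝒜 f := hyf
    rw [Proj.basicOpen_eq_iSup_proj, TopologicalSpace.Opens.mem_iSup] at hyf'
    obtain ⟨m, hm⟩ := hyf'
    obtain ⟨t, ht, hyt⟩ := h1 (i y)
    -- The factor `t` ensures that the degree is positive.
    refine ⟨GradedRing.proj 𝒜 m f * t, m + 1, m.succ_pos,
      SetLike.mul_mem_graded (SetLike.coe_mem _) ht, ?_, ?_⟩
    · rw [Proj.basicOpen_mul]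
      exact ⟨hm, hyt⟩
    · rw [Proj.basicOpen_mul]
      refine inf_le_left.trans (le_trans ?_ hfO)
      rw [Proj.basicOpen_eq_iSup_proj 𝒜 f]
      exact le_iSup (fun m => Proj.basicOpen 𝒜 (GradedRing.proj 𝒜 m f)) m
  have hW : IsAffineOpen (i ⁻¹ᵁ Proj.basicOpen 𝒜 s) := by
    have h2 := ((Proj.isAffineOpen_basicOpen 𝒜 s hs hd).preimage_of_isOpenImmersion
      i.coborderRange.ι (by simpa using hsO)).preimage i.liftCoborder
    rwa [← Scheme.Hom.comp_preimage, Scheme.Hom.liftCoborder_ι] at h2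
  -- Near a point over `D₊(t)` with `t` of degree one, the divisor is given by `s / t ^ d`.
  choose t ht hpt using h1
  have htd : ∀ p, t p ^ d ∈ 𝒜 d := fun p => by
    simpa using SetLike.pow_mem_graded d (ht p)
  have hptd : ∀ p q, q ∈ Proj.basicOpen 𝒜 (t p) → q ∈ Proj.basicOpen 𝒜 (t p ^ d) := fun p q hq => by
    rwa [Proj.basicOpen_pow _ _ _ hd]
  have hspec : ∀ z : Y, i (genericPoint Y) ⤳ i z := fun z =>
    (genericPoint_specializes z).map i.continuous
  have hgs : i (genericPoint Y) ∈ Proj.basicOpen 𝒜 s :=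
    (hspec y).mem_open (Proj.basicOpen 𝒜 s).2 hys
  have hgt : ∀ p z, i z ∈ Proj.basicOpen 𝒜 (t p) →
      i (genericPoint Y) ∈ Proj.basicOpen 𝒜 (t p ^ d) := fun p z hz =>
    hptd p _ ((hspec z).mem_open (Proj.basicOpen 𝒜 (t p)).2 hz)
  have hres : ∀ (z : Y) {a b : A} (ha : a ∈ 𝒜 d) (hb : b ∈ 𝒜 d)
      (hz : i z ∈ Proj.basicOpen 𝒜 b) (hg : i (genericPoint Y) ∈ Proj.basicOpen 𝒜 b),
      algebraMap _ Y.functionField (i.stalkMap z (stalkFraction 𝒜 (i z) ha hb hz)) =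
        i.stalkMap (genericPoint Y) (stalkFraction 𝒜 _ ha hb hg) := by
    intro z a b ha hb hz hg
    rw [← stalkSpecializes_stalkFraction (hspec z) ha hb hz]
    exact (Scheme.Hom.stalkSpecializes_stalkMap_apply i _ _ (genericPoint_specializes z) _).symm
  have hunit : ∀ (z : Y) {a b : A} (ha : a ∈ 𝒜 d) (hb : b ∈ 𝒜 d)
      (hz : i z ∈ Proj.basicOpen 𝒜 b),
      IsUnit (i.stalkMap z (stalkFraction 𝒜 (i z) ha hb hz)) ↔ i z ∈ Proj.basicOpen 𝒜 a :=
    fun z a b ha hb hz => by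
      rw [← isUnit_stalkFraction_iff ha hb hz]
      exact isUnit_map_iff (i.stalkMap z).hom _
  have hgunit : ∀ z : Y, IsUnit (i.stalkMap (genericPoint Y)
      (stalkFraction 𝒜 _ hs (htd (i z)) (hgt (i z) z (hpt (i z)))) : Y.functionField) :=
    fun z => (hunit _ _ _ _).mpr hgs
  refine ⟨i ⁻¹ᵁ Proj.basicOpen 𝒜 s,
    { chart := fun z => i ⁻¹ᵁ Proj.basicOpen 𝒜 (t (i z))
      mem_chart := fun z => hpt (i z)
      eqn := fun z => (hgunit z).unit
      compat := fun x x' z hx hx' => ?_ }, hW, hys, fun x z hz => ?_⟩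
  · refine ⟨((hunit z (htd (i x')) (htd (i x)) (hptd _ _ hx)).mpr (hptd _ _ hx')).unit, ?_⟩
    rw [IsUnit.unit_spec, IsUnit.unit_spec, IsUnit.unit_spec,
      hres z _ _ _ (hgt (i x) x (hpt (i x))), ← map_mul, ← stalkFraction_eq_mul]
  · exact ⟨_, hres z hs (htd (i x)) (hptd _ _ hz) _, hunit z _ _ _⟩

end

section

section EffectiveDivisor

variable {Y : Scheme.{u}} [IsIntegral Y]

/-- A Cartier divisor with local equations that are regular, and invertible exactly on a nonempty
open `W`, gives an effective Weil divisor whose support is the complement of `W`. -/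
theorem exists_weilDivisor_of_cartierDivisor [IsNoetherian Y] (hY : IsNormal Y) {W : Y.Opens}
    [Nonempty W] {C : CartierDivisor Y}
    (hC : ∀ x z : Y, z ∈ C.chart x → ∃ a : Y.presheaf.stalk z,
        algebraMap _ Y.functionField a = C.eqn x ∧ (IsUnit a ↔ z ∈ W)) :
    ∃ H ∈ cartierDivisors Y, ∀ P : PrimeDivisor Y, 0 ≤ H P ∧ (H P = 0 ↔ P.1 ∈ W) := by
  have hzero : ∀ (x : Y) (P : PrimeDivisor Y), P.1 ∈ C.chart x →
      (Scheme.ord (C.eqn x : Y.functionField) P.1 = 0 ↔ P.1 ∈ W) := by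
    intro x P hP
    obtain ⟨a, ha, haW⟩ := hC x P.1 hP
    rw [← haW, ← ha]
    refine ⟨fun h => isUnit_of_ord_algebraMap_eq_zero P.2 ?_ h (hY P.1).2,
      fun h => ord_algebraMap_unit P.1 h.unit⟩
    rintro rfl
    exact (C.eqn x).ne_zero (by rw [← ha, map_zero])
  have hfin : {P : PrimeDivisor Y | P.1 ∉ W}.Finite :=
    Set.Finite.of_finite_image ((finite_coheight_eq_one_notMem W).subset
      (by rintro _ ⟨P, hP, rfl⟩; exact ⟨P.2, hP⟩)) Subtype.val_injective.injOn
  let H : WeilDivisor Y := Finsupp.ofSupportFinite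
    (fun P => Scheme.ord (C.eqn P.1 : Y.functionField) P.1)
    (hfin.subset fun P hP hPW => hP ((hzero _ P (C.mem_chart _)).mpr hPW))
  refine ⟨H, ⟨C, fun x P hP => ?_⟩, fun P => ⟨?_, hzero _ P (C.mem_chart _)⟩⟩
  · obtain ⟨v, hv⟩ := C.compat P.1 x P.1 (C.mem_chart _) hP
    change Scheme.ord (C.eqn P.1 : Y.functionField) P.1 = _
    rw [hv, Scheme.ord_mul (by simp) (C.eqn x).ne_zero, ord_algebraMap_unit, zero_add]
  · obtain ⟨a, ha, -⟩ := hC P.1 P.1 (C.mem_chart _)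
    exact ord_nonneg_of_mem_range ⟨a, ha⟩

end EffectiveDivisor

theorem exists_linear_form_mem_basicOpen (k : Type u) [Field k] (n : ℕ)
    (p : Proj (MvPolynomial.homogeneousSubmodule (Fin (n + 1)) k)) :
    ∃ t ∈ MvPolynomial.homogeneousSubmodule (Fin (n + 1)) k 1,
      p ∈ Proj.basicOpen (MvPolynomial.homogeneousSubmodule (Fin (n + 1)) k) t := by
  have h := Proj.iSup_basicOpen_eq_top' (MvPolynomial.homogeneousSubmodule (Fin (n + 1)) k)
    (MvPolynomial.X : Fin (n + 1) → MvPolynomial (Fin (n + 1)) k)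
    (fun j => ⟨1, MvPolynomial.isHomogeneous_X k j⟩) (by
      rw [eq_top_iff]
      intro f _
      have hf : f ∈ Algebra.adjoin k (Set.range (MvPolynomial.X : Fin (n + 1) → _)) := by
        rw [MvPolynomial.adjoin_range_X]
        trivial
      induction hf using Algebra.adjoin_induction with
      | mem x hx => exact Algebra.subset_adjoin hx
      | algebraMap r =>
        exact Subalgebra.algebraMap_mem _
          (⟨MvPolynomial.C r, MvPolynomial.isHomogeneous_C _ r⟩ :
            MvPolynomial.homogeneousSubmodule (Fin (n + 1)) k 0)
      | add x y _ _ hx hy => exact add_mem (hx trivial) (hy trivial)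
      | mul x y _ _ hx hy => exact mul_mem (hx trivial) (hy trivial))
  have hp : p ∈ ⨆ j, Proj.basicOpen (MvPolynomial.homogeneousSubmodule (Fin (n + 1)) k)
      (MvPolynomial.X j) := by
    rw [h]
    trivial
  obtain ⟨j, hj⟩ := TopologicalSpace.Opens.mem_iSup.mp hp
  exact ⟨_, MvPolynomial.isHomogeneous_X k j, hj⟩

/-! ### Injectivity on rational class groups forces a local isomorphism -/

section StrictTransform

variable {X Y : Scheme.{u}} [IsIntegral X] [IsIntegral Y] [IsLocallyNoetherian X]
  [IsLocallyNoetherian Y] (φ : Y ⟶ X) (h : φ (genericPoint Y) = genericPoint X)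
  (hcod : ∀ y : Y, Order.coheight y = 1 → IsIso (φ.stalkMap y))

include h in
/-- If the strict transform of an effective `ℚ`-Cartier divisor `E` misses `y`, then `E` misses
`φ y`. -/
theorem apply_eq_zero_of_nsmul_mem_cartierDivisors (hX : IsNormal X) (hY : IsNormal Y)
    {E : WeilDivisor X} (hE : ∀ P, 0 ≤ E P) {n : ℕ} (hn : 0 < n)
    (hnE : n • E ∈ cartierDivisors X) (y : Y)
    (hy : ∀ Q : PrimeDivisor Y, Q.1 ⤳ y → E (primeDivisorMap φ hcod Q) = 0)
    (P : PrimeDivisor X) (hP : P.1 ⤳ φ y) : E P = 0 := by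
  obtain ⟨C, hC⟩ := hnE
  set g := C.eqn (φ y) with hg
  have hord : ∀ P : PrimeDivisor X, P.1 ⤳ φ y →
      Scheme.ord (g : X.functionField) P.1 = n * E P := by
    intro P hP
    rw [← hC (φ y) P (hP.mem_open (C.chart (φ y)).2 (C.mem_chart _)), Finsupp.smul_apply,
      nsmul_eq_mul]
  have hgX : (g : X.functionField) ∈ (algebraMap (X.presheaf.stalk (φ y)) X.functionField).range :=
    mem_range_algebraMap_stalk_of_forall_coheight_eq_one (φ y) (hX _).2 fun η hη hη1 =>
      mem_range_of_ord_nonneg hη1 (hX _).2 g.ne_zero (by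
        rw [hord ⟨η, hη1⟩ hη]
        exact mul_nonneg n.cast_nonneg (hE _))
  let g' : Y.functionFieldˣ := Units.map (functionFieldMap φ h).hom.toMonoidHom g
  have hord' : ∀ Q : PrimeDivisor Y, Q.1 ⤳ y → Scheme.ord (g' : Y.functionField) Q.1 = 0 := by
    intro Q hQ
    rw [ord_map_functionFieldMap φ h hcod hX hY, hord _ (hQ.map φ.continuous), hy Q hQ, mul_zero]
  have hmem : ∀ f : Y.functionFieldˣ,
      (∀ Q : PrimeDivisor Y, Q.1 ⤳ y → Scheme.ord (f : Y.functionField) Q.1 = 0) →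
      (f : Y.functionField) ∈ (algebraMap (Y.presheaf.stalk y) Y.functionField).range :=
    fun f hf => mem_range_algebraMap_stalk_of_forall_coheight_eq_one y (hY _).2 fun η hη hη1 =>
      mem_range_of_ord_nonneg hη1 (hY _).2 f.ne_zero (hf ⟨η, hη1⟩ hη).ge
  obtain ⟨a, ha⟩ := hmem g' hord'
  obtain ⟨b, hb⟩ := hmem g'⁻¹ fun Q hQ => by rw [ord_units_inv, hord' Q hQ, neg_zero]
  have hab : a * b = 1 := by
    apply IsFractionRing.injective (Y.presheaf.stalk y) Y.functionField
    rw [map_mul, ha, hb, Units.mul_inv, map_one]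
  obtain ⟨w, hw⟩ := isUnit_of_isUnit_functionFieldMap φ h hgX (v := Units.mkOfMulEqOne a b hab)
    ha.symm
  have h0 := hord P hP
  rw [hw, ← algebraMap_stalkSpecializes hP] at h0
  have h1 := ord_algebraMap_unit P.1 (Units.map (X.presheaf.stalkSpecializes hP).hom.toMonoidHom w)
  have h2 : (n : ℤ) * E P = 0 := h0.symm.trans h1
  exact (mul_eq_zero.mp h2).resolve_left (by exact_mod_cast hn.ne')

/-- If the rank does not drop, `φ` is a local isomorphism at each point `y` that admits an effective
Cartier divisor avoiding `y` with affine complement. -/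
theorem stalkMap_bijective_of_rank_not_lt (hX : IsNormal X) (hY : IsNormal Y)
    (hinj : Function.Injective (primeDivisorMap φ hcod)) [IsIso (functionFieldMap φ h)]
    (hfin : Module.rank ℚ (ClModPicRat X) < Cardinal.aleph0)
    (hrank : ¬ Module.rank ℚ (ClModPicRat Y) < Module.rank ℚ (ClModPicRat X))
    {y : Y} {W : Y.Opens} (hW : IsAffineOpen W) (hyW : y ∈ W) {H : WeilDivisor Y}
    (hH : H ∈ cartierDivisors Y) (hHW : ∀ P : PrimeDivisor Y, 0 ≤ H P ∧ (H P = 0 ↔ P.1 ∈ W)) :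
    Function.Bijective (φ.stalkMap y) := by
  -- Every prime divisor of `X` through `φ y` is the image of one of `Y`.
  have hrange : ∀ P : PrimeDivisor X, P.1 ⤳ φ y → ∃ Q, primeDivisorMap φ hcod Q = P := by
    intro P hP
    by_contra! hcon
    have h0 : Finsupp.comapDomain.addMonoidHom hinj (Finsupp.single P (1 : ℤ)) = 0 := by
      ext Q
      exact Finsupp.single_eq_of_ne (hcon Q)
    obtain ⟨n, hn, hnE⟩ := exists_nsmul_mem_cartierDivisors φ h hcod hinj hX hY hfin hrank
      (D := Finsupp.single P (1 : ℤ)) (h0 ▸ zero_mem _)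
    classical
    have h1 := apply_eq_zero_of_nsmul_mem_cartierDivisors φ h hcod hX hY
      (fun P' => by rw [Finsupp.single_apply]; split_ifs <;> simp) hn hnE y
      (fun Q _ => Finsupp.single_eq_of_ne (hcon Q)) P hP
    simp at h1
  -- The strict transform of `H` misses `φ y`, so these prime divisors of `Y` meet `W`.
  have hmemW : ∀ Q : PrimeDivisor Y, (primeDivisorMap φ hcod Q).1 ⤳ φ y → Q.1 ∈ W := by
    intro Q hQ
    have hE : ∀ Q, H.mapDomain (primeDivisorMap φ hcod) (primeDivisorMap φ hcod Q) = H Q :=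
      fun Q => Finsupp.mapDomain_apply hinj H Q
    have h0 : Finsupp.comapDomain.addMonoidHom hinj (H.mapDomain (primeDivisorMap φ hcod)) = H :=
      Finsupp.comapDomain_mapDomain _ hinj H
    obtain ⟨n, hn, hnE⟩ := exists_nsmul_mem_cartierDivisors φ h hcod hinj hX hY hfin hrank
      (D := H.mapDomain (primeDivisorMap φ hcod)) (by rwa [h0])
    rw [← (hHW Q).2, ← hE]
    refine apply_eq_zero_of_nsmul_mem_cartierDivisors φ h hcod hX hY (fun P => ?_) hn hnE y
      (fun Q' hQ' => ?_) _ hQ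
    · by_cases hP : P ∈ Set.range (primeDivisorMap φ hcod)
      · obtain ⟨Q', rfl⟩ := hP
        rw [hE]
        exact (hHW Q').1
      · rw [Finsupp.mapDomain_of_notMem_range _ _ hP]
    · rw [hE, (hHW Q').2]
      exact hQ'.mem_open W.2 hyW
  -- Hence sections over `W` are regular at `φ y`, by Hartogs.
  have : Nonempty W := ⟨⟨y, hyW⟩⟩
  have hsec : ∀ a : Γ(Y, W), ∃ c : X.presheaf.stalk (φ y),
      φ.stalkMap y c = Y.presheaf.germ W y hyW a := by
    intro a
    by_cases ha : a = 0
    · exact ⟨0, by rw [ha, map_zero, map_zero]⟩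
    obtain ⟨f, hf⟩ : ∃ f, functionFieldMap φ h f = Y.germToFunctionField W a :=
      (ConcreteCategory.bijective_of_isIso (functionFieldMap φ h)).2 _
    have hf0 : f ≠ 0 := by
      rintro rfl
      rw [map_zero] at hf
      exact ha (Scheme.germToFunctionField_injective Y W (by rw [← hf, map_zero]))
    obtain ⟨c, hc⟩ := mem_range_algebraMap_stalk_of_forall_coheight_eq_one (φ y) (hX _).2
      (f := f) fun η hη hη1 => by
        obtain ⟨Q, hQ⟩ := hrange ⟨η, hη1⟩ hη
        have hQW := hmemW Q (by rwa [hQ])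
        refine mem_range_of_ord_nonneg hη1 (hX _).2 hf0 ?_
        have h1 := ord_map_functionFieldMap φ h hcod hX hY (Units.mk0 f hf0) Q
        have h2 : 0 ≤ Scheme.ord (Y.germToFunctionField W a) Q.1 :=
          ord_nonneg_of_mem_range
            ⟨_, Scheme.algebraMap_germ_eq_germToFunctionField Y hQW a⟩
        rw [hQ] at h1
        rw [← hf] at h2
        exact h2.trans_eq h1
    refine ⟨c, IsFractionRing.injective (Y.presheaf.stalk y) Y.functionField ?_⟩
    rw [← functionFieldMap_algebraMap φ h, hc, hf,
      Scheme.algebraMap_germ_eq_germToFunctionField]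
  refine ⟨fun a b hab => ?_, fun z => ?_⟩
  · apply IsFractionRing.injective (X.presheaf.stalk (φ y)) X.functionField
    apply (ConcreteCategory.bijective_of_isIso (functionFieldMap φ h)).1
    rw [functionFieldMap_algebraMap, functionFieldMap_algebraMap, hab]
  · have hloc := hW.isLocalization_stalk ⟨y, hyW⟩
    let _alg := TopCat.Presheaf.algebra_section_stalk Y.presheaf (⟨y, hyW⟩ : W)
    obtain ⟨⟨a, s⟩, has⟩ := IsLocalization.surj (hW.primeIdealOf ⟨y, hyW⟩).asIdeal.primeCompl z
    have hs : IsUnit (Y.presheaf.germ W y hyW s.1) :=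
      IsLocalization.map_units (Y.presheaf.stalk y) s
    have has' : z * Y.presheaf.germ W y hyW s.1 = Y.presheaf.germ W y hyW a := has
    obtain ⟨c, hc⟩ := hsec a
    obtain ⟨d, hd⟩ := hsec s.1
    have hdu : IsUnit d := isUnit_of_map_unit (φ.stalkMap y).hom d (by
      change IsUnit (φ.stalkMap y d)
      rwa [hd])
    obtain ⟨e, he⟩ := hdu.exists_right_inv
    refine ⟨c * e, hs.mul_left_injective ?_⟩
    change φ.stalkMap y (c * e) * _ = z * _
    rw [has', ← hd, ← map_mul, mul_assoc, mul_comm e d, he, mul_one, hc]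

end StrictTransform

end

end DivisorClass

end

theorem mainTheorem3 {k : Type u} [Field k] (X Y : DivisorClass.Variety k)
    (hXn : DivisorClass.IsNormal X.scheme) (hYn : DivisorClass.IsNormal Y.scheme)
    (hXq : X.IsQuasiProjective) (hYq : Y.IsQuasiProjective)
    (φ : Y.scheme ⟶ X.scheme) (hφk : φ ≫ X.hom = Y.hom)
    (hφ : DivisorClass.IsBirational φ)
    (hE : 2 ≤ DivisorClass.codim (DivisorClass.exceptionalLocus φ))
    (hfin : Module.rank ℚ (DivisorClass.ClModPicRat X.scheme) < Cardinal.aleph0)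
    (hφo : ¬ IsOpenImmersion φ) :
    Module.rank ℚ (DivisorClass.ClModPicRat Y.scheme) <
      Module.rank ℚ (DivisorClass.ClModPicRat X.scheme) := by
  by_contra hrank
  apply hφo
  have hsep : IsSeparated φ := by
    have : IsSeparated (φ ≫ X.hom) := hφk ▸ inferInstance
    exact IsSeparated.of_comp φ X.hom
  have hft : LocallyOfFiniteType φ := by
    have : LocallyOfFiniteType (φ ≫ X.hom) := hφk ▸ inferInstance
    exact locallyOfFiniteType_of_comp φ X.hom
  have hfp : LocallyOfFinitePresentation φ := inferInstance
  have hnoeth : IsNoetherian Y.scheme := by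
    have : CompactSpace Y.scheme := QuasiCompact.compactSpace_of_compactSpace Y.hom
    exact {}
  -- The generic point lies in the locus where `φ` is a local isomorphism.
  obtain ⟨U, hU, hUφ⟩ : ∃ U : Y.scheme.Opens, Nonempty U ∧ IsOpenImmersion (U.ι ≫ φ) := by
    obtain ⟨p, hp⟩ := hφ
    refine ⟨p.source, p.dense_source.nonempty.to_subtype, ?_⟩
    rw [← hp]
    infer_instance
  have hgenU : genericPoint Y.scheme ∈ U :=
    ((genericPoint_spec Y.scheme).mem_open_set_iff U.2).mpr (by simpa using hU)
  have hgen : φ (genericPoint Y.scheme) = genericPoint X.scheme := by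
    rw [← genericPoint_eq_of_isOpenImmersion U.ι, ← Scheme.Hom.comp_apply,
      genericPoint_eq_of_isOpenImmersion (U.ι ≫ φ)]
  have hgenIso := DivisorClass.isIso_stalkMap_of_isOpenImmersion_ι_comp φ U hgenU
  have hffIso : IsIso (DivisorClass.functionFieldMap φ hgen) :=
    DivisorClass.isIso_functionFieldMap φ hgen
  have hcod : ∀ y : Y.scheme, Order.coheight y = 1 → IsIso (φ.stalkMap y) := by
    intro y hy
    have hyE : y ∉ DivisorClass.exceptionalLocus φ := fun hyE => by
      have h1 : (2 : ℕ∞) ≤ Order.coheight y := hE.trans (iInf₂_le y hyE)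
      rw [hy] at h1
      exact absurd h1 (by decide)
    have hy' : y ∈ sSup {U : Y.scheme.Opens | IsOpenImmersion (U.ι ≫ φ)} := not_not.mp hyE
    obtain ⟨V, hV, hyV⟩ : ∃ V : Y.scheme.Opens, IsOpenImmersion (V.ι ≫ φ) ∧ y ∈ V :=
      TopologicalSpace.Opens.mem_sSup.mp hy'
    exact DivisorClass.isIso_stalkMap_of_isOpenImmersion_ι_comp φ V hyV
  have hbij : ∀ y : Y.scheme, Function.Bijective (φ.stalkMap y) := by
    intro y
    obtain ⟨n, i, hi, -⟩ := hYq
    have hi' : @IsImmersion Y.scheme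
        (Proj (MvPolynomial.homogeneousSubmodule (Fin (n + 1)) k)) i := hi
    obtain ⟨W, C, hW, hyW, hC⟩ := DivisorClass.exists_cartierDivisor_proj
      (DivisorClass.exists_linear_form_mem_basicOpen k n) i y
    have : Nonempty W := ⟨⟨y, hyW⟩⟩
    obtain ⟨H, hH, hHW⟩ := DivisorClass.exists_weilDivisor_of_cartierDivisor hYn hC
    exact DivisorClass.stalkMap_bijective_of_rank_not_lt φ hgen hcod hXn hYn
      (DivisorClass.primeDivisorMap_injective φ hgen hcod) hfin hrank hW hyW hH hHW
  have hiso : ∀ y : Y.scheme, IsIso (φ.stalkMap y) := fun y =>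
    (ConcreteCategory.isIso_iff_bijective _).mpr (hbij y)
  have hflat : Flat φ := Flat.of_stalkMap φ fun y => RingHom.Flat.of_bijective (hbij y)
  have hsurj : SurjectiveOnStalks φ := ⟨fun y => (hbij y).2⟩
  have hmono : Mono φ := SurjectiveOnStalks.mono_of_injective fun y y' e =>
    DivisorClass.eq_of_isIso_stalkMap φ hgen e
  exact IsOpenImmersion.of_flat_of_mono φ
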